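/- A combinatorial auction has a set $M$ of $m$ items and $n$ bidders with valuations $v_i : 2^M \to \mathbb{R}_{\ge 0}$ that are non-decreasing and satisfy $v_i(\emptyset)=0$; $v_i$ is submodular if $v_i(S)+v_i(T)\ge v_i(S\cap T)+v_i(S\cup T)$ for all $S,T\subseteq M$. An allocation is a partition $(S_1,\dots,S_n)$ of $M$ (empty parts are allowed), and it is optimal if it maximizes $\sum_i v_i(S_i)$. For $\gamma\ge 1$, the $\gamma$-perturbation of $\vec v$ on bidder $i$ and item $j$ replaces $v_i$ by $v_i'(S)=v_i(S)+(\gamma-1)\,v_i(S\cap\{j\})$ and leaves the other valuations unchanged. The profile $\vec v$ is $\gamma$-stable if it has a unique optimal allocation and this allocation is also the unique optimal allocation of every $\gamma$-perturbation of $\vec v$. A (deterministic) value-query mechanism adaptively asks finitely many value queries "what is $v_i(S)$?" and then, depending on the answers, outputs pairwise disjoint bundles $S_1,\dots,S_n\subseteq M$ and real payments $p_1,\dots,p_n$; the utility of bidder $i$ is $v_i(S_i)-p_i$. It is DSIC (on submodular valuations) if for every bidder $i$ with submodular true valuation, and for all submodular valuations according to which the other bidders answer, truthful answers give $i$ non-negative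 utility that is at least the utility from answering according to any other submodular valuation. **Theorem.** There is an absolute constant $c>0$ such that for every $\gamma\ge 1$ there is an $m_0=m_0(\gamma)$ with the following property. Let $m\ge m_0$ and $n\ge 2$, and let $\mathcal{A}$ be a value-query mechanism for $n$ bidders and $m$ items that is DSIC and that, under truthful answers, outputs an optimal allocation on every $\gamma$-stable profile of submodular valuations. Then there is a profile of submodular valuations on which $\mathcal{A}$ makes at least $2^{cm}$ value queries. That is, every such mechanism makes exponentially many value queries in the worst case. -/

import Mathlib

/-- A real set function on the bundles of the `m` items. -/
abbrev SetFn (m : ℕ) : Type := Finset (Fin m) → ℝ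

/-- Valuations: normalized and non-decreasing (hence non-negative). -/
def IsValuation {m : ℕ} (v : SetFn m) : Prop :=
  v ∅ = 0 ∧ ∀ S T : Finset (Fin m), S ⊆ T → v S ≤ v T

/-- Submodular valuations. -/
def IsSubmodular {m : ℕ} (v : SetFn m) : Prop :=
  IsValuation v ∧ ∀ S T : Finset (Fin m), v (S ∩ T) + v (S ∪ T) ≤ v S + v T

/-- An allocation is a partition of the items among the bidders. -/
def IsAllocation {n m : ℕ} (S : Fin n → Finset (Fin m)) : Prop :=
  ∀ j : Fin m, ∃! i : Fin n, j ∈ S i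

/-- Social welfare. -/
def welfare {n m : ℕ} (v : Fin n → SetFn m) (S : Fin n → Finset (Fin m)) : ℝ :=
  ∑ i, v i (S i)

/-- `S` is an optimal allocation for the profile `v`. -/
def IsOptimal {n m : ℕ} (v : Fin n → SetFn m) (S : Fin n → Finset (Fin m)) : Prop :=
  IsAllocation S ∧ ∀ S' : Fin n → Finset (Fin m), IsAllocation S' → welfare v S' ≤ welfare v S

/-- `S` is the unique optimal allocation for the profile `v`. -/
def IsUniqueOptimal {n m : ℕ} (v : Fin n → SetFn m) (S : Fin n → Finset (Fin m)) : Prop :=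
  IsOptimal v S ∧ ∀ S' : Fin n → Finset (Fin m), IsOptimal v S' → S' = S

/-- The `γ`-perturbation of the profile `v` on bidder `i` and item `j`. -/
def perturb {n m : ℕ} (γ : ℝ) (v : Fin n → SetFn m) (i : Fin n) (j : Fin m) : Fin n → SetFn m :=
  Function.update v i (fun S => v i S + (γ - 1) * v i (S ∩ {j}))

/-- `γ`-stability: the optimal allocation is unique, and it remains the unique optimal allocation
in every `γ`-perturbation. -/
def IsStable {n m : ℕ} (γ : ℝ) (v : Fin n → SetFn m) : Prop :=
  ∃ O : Fin n → Finset (Fin m), IsUniqueOptimal v O ∧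
    ∀ (i : Fin n) (j : Fin m), IsUniqueOptimal (perturb γ v i j) O

/-- An outcome of a mechanism: disjoint bundles (items may stay unsold) and payments. -/
structure Outcome (n m : ℕ) where
  bundle : Fin n → Finset (Fin m)
  disjoint : ∀ i k : Fin n, i ≠ k → Disjoint (bundle i) (bundle k)
  payment : Fin n → ℝ

/-- Deterministic mechanisms with value queries only: adaptive decision trees. A mechanism either
finishes with an outcome, or asks bidder `i` for the value of the bundle `S` and continues depending
on the real number that is answered. Every run is finite. -/
inductive ValueQueryMechanism (n m : ℕ) : Type
  | finish (o : Outcome n m) : ValueQueryMechanism n m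
  | query (i : Fin n) (S : Finset (Fin m)) (next : ℝ → ValueQueryMechanism n m) :
      ValueQueryMechanism n m

/-- The outcome when every bidder `i` answers the queries according to `b i`. -/
def ValueQueryMechanism.run {n m : ℕ} (b : Fin n → SetFn m) :
    ValueQueryMechanism n m → Outcome n m
  | .finish o => o
  | .query i S next => (next (b i S)).run b

/-- The number of value queries made when every bidder `i` answers according to `b i`. -/
def ValueQueryMechanism.numQueries {n m : ℕ} (b : Fin n → SetFn m) :
    ValueQueryMechanism n m → ℕ
  | .finish _ => 0
  | .query i S next => (next (b i S)).numQueries b + 1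

/-- Quasi-linear utility of bidder `i` with true valuation `v` for an outcome. -/
def Outcome.utility {n m : ℕ} (o : Outcome n m) (i : Fin n) (v : SetFn m) : ℝ :=
  v (o.bundle i) - o.payment i

/-- DSIC on submodular valuations: whatever submodular valuations the other bidders answer by,
a bidder `i` with true submodular valuation `b i` cannot gain by answering according to some other
submodular valuation `w`, and gets non-negative utility by answering truthfully. -/
def ValueQueryMechanism.IsDSIC {n m : ℕ} (A : ValueQueryMechanism n m) : Prop :=
  ∀ b : Fin n → SetFn m, (∀ k, IsSubmodular (b k)) → ∀ i : Fin n,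
    (∀ w : SetFn m, IsSubmodular w →
      (A.run (Function.update b i w)).utility i (b i) ≤ (A.run b).utility i (b i)) ∧
    0 ≤ (A.run b).utility i (b i)

/-- With truthful answers, the mechanism outputs an optimal allocation on every `γ`-stable profile
of submodular valuations. -/
def ValueQueryMechanism.FindsOptimal {n m : ℕ} (A : ValueQueryMechanism n m) (γ : ℝ) : Prop :=
  ∀ v : Fin n → SetFn m, (∀ i, IsSubmodular (v i)) → IsStable γ v → IsOptimal v (A.run v).bundle

/-!
Fix bidder `1` to the additive valuation `S ↦ |S|` and every bidder other than `0`, `1` to zero.  For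
each bundle `T`, if bidder `0` has the additive valuation worth `α = 2γ` on each item of `T` and
`β = 1/(2γ)` on each other item, the profile is `γ`-stable and its optimum gives `T` to bidder `0`
(`isStable_additive`).  Hence bidder `0` can buy *every* bundle `T`, at some price `p T`, and
truthfulness forces the price of any other purchasable bundle `B` to be at least
`p T + β |B \ T| - α |T \ B|` (`exists_prices`).  In particular all prices lie in an interval of length
`α m`, and strict supersets cost at least `β` more.

By the pigeonhole principle there is an exponentially large family `F` of bundles of equal size whose
prices differ by less than `β / 2` (`exists_large_priced_family`).  Since values may be arbitrarily
large, some submodular valuation makes every bundle that contains no member of `F` hopelessly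
bad (`deficit`): the deficit `D * 2 ^ |Sᶜ|` decreases so quickly in `S` that supermodularity holds
whatever the antichain `F` is.  Bundles strictly above `F` have no deficit, and members of `F` have
deficit `β`.  Removing the deficit of a single `T ∈ F` makes buying `T` better than any other purchase
by more than `β / 2`, but this can be noticed only by querying `T`.  So all members of `F`
but at most one, the one that is sold, are queried (`card_le_numQueries_add_one`).
-/

open Finset

/-! ### Additive valuations and stability -/

/-- The additive valuation with item values `a`. -/
def additive {m : ℕ} (a : Fin m → ℝ) : SetFn m := fun S => ∑ j ∈ S, a j

lemma isSubmodular_additive {m : ℕ} {a : Fin m → ℝ} (ha : ∀ j, 0 ≤ a j) :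
    IsSubmodular (additive a) := by
  refine ⟨⟨by simp [additive], fun S T h => ?_⟩, fun S T => ?_⟩
  · exact sum_le_sum_of_subset_of_nonneg h fun j _ _ => ha j
  · have := sum_union_inter (s₁ := S) (s₂ := T) (f := a)
    simp only [additive]
    linarith

/-- The allocation giving each item `j` to its owner `o j`. -/
def ownerAllocation {n m : ℕ} (o : Fin m → Fin n) : Fin n → Finset (Fin m) :=
  fun i => univ.filter fun j => o j = i

lemma isAllocation_ownerAllocation {n m : ℕ} (o : Fin m → Fin n) :
    IsAllocation (ownerAllocation o) :=
  fun j => ⟨o j, by simp [ownerAllocation], fun i hi => by simpa [ownerAllocation, eq_comm] using hi⟩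

lemma IsAllocation.exists_owner {n m : ℕ} {S : Fin n → Finset (Fin m)} (h : IsAllocation S) :
    ∃ s : Fin m → Fin n, S = ownerAllocation s := by
  choose s hs hs' using h
  refine ⟨s, ?_⟩
  ext i j
  simp only [ownerAllocation, mem_filter, mem_univ, true_and]
  exact ⟨fun hj => (hs' j i hj).symm, fun hj => hj ▸ hs j⟩

lemma welfare_additive {n m : ℕ} (a : Fin n → Fin m → ℝ) (s : Fin m → Fin n) :
    welfare (fun i => additive (a i)) (ownerAllocation s) = ∑ j, a (s j) j := by
  simp only [welfare, additive, ownerAllocation, sum_filter]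
  rw [sum_comm]
  simp

lemma isUniqueOptimal_additive {n m : ℕ} {a : Fin n → Fin m → ℝ} {o : Fin m → Fin n}
    (h : ∀ j i, i ≠ o j → a i j < a (o j) j) :
    IsUniqueOptimal (fun i => additive (a i)) (ownerAllocation o) := by
  have hle : ∀ j i, a i j ≤ a (o j) j := fun j i => by
    by_cases hi : i = o j
    · rw [hi]
    · exact (h j i hi).le
  refine ⟨⟨isAllocation_ownerAllocation o, fun S' hS' => ?_⟩, fun S' hS' => ?_⟩
  · obtain ⟨s, rfl⟩ := hS'.exists_owner
    rw [welfare_additive, welfare_additive]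
    exact sum_le_sum fun j _ => hle j _
  · obtain ⟨s, rfl⟩ := hS'.1.exists_owner
    by_contra hne
    have : ∃ j, s j ≠ o j := by
      by_contra! hso
      exact hne (by rw [funext hso])
    obtain ⟨j, hj⟩ := this
    have hopt := hS'.2 _ (isAllocation_ownerAllocation o)
    rw [welfare_additive, welfare_additive] at hopt
    exact absurd (sum_lt_sum (fun j _ => hle j (s j)) ⟨j, mem_univ j, h j _ hj⟩) hopt.not_gt

/-- The perturbation of an additive profile is the additive profile in which a single item value
is multiplied by `γ`. -/
lemma perturb_additive {n m : ℕ} (γ : ℝ) (a : Fin n → Fin m → ℝ) (i : Fin n) (j : Fin m) :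
    perturb γ (fun i => additive (a i)) i j =
      fun i' => additive fun j' => if i' = i ∧ j' = j then γ * a i' j' else a i' j' := by
  funext i' S
  by_cases hi : i' = i
  · subst hi
    simp only [perturb, Function.update_self, additive, true_and]
    have h1 : ∀ j', (if j' = j then γ * a i' j' else a i' j')
        = a i' j' + if j' = j then (γ - 1) * a i' j' else 0 := fun j' => by
      split_ifs <;> ring
    rw [sum_congr rfl fun j' _ => h1 j', sum_add_distrib, sum_ite_eq' S j]
    by_cases hj : j ∈ S
    · simp [hj, inter_singleton_of_mem]
    · simp [hj, inter_singleton_of_notMem]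
  · simp [perturb, additive, hi]

/-- An additive profile is stable if each item's owner values it more than `γ` times as much as
anybody else does. -/
lemma isStable_additive {n m : ℕ} {γ : ℝ} (hγ : 1 ≤ γ) {a : Fin n → Fin m → ℝ}
    (ha : ∀ i j, 0 ≤ a i j) {o : Fin m → Fin n} (h : ∀ j i, i ≠ o j → γ * a i j < a (o j) j) :
    IsUniqueOptimal (fun i => additive (a i)) (ownerAllocation o) ∧
      IsStable γ (fun i => additive (a i)) := by
  have hle : ∀ i j, a i j ≤ γ * a i j := fun i j => le_mul_of_one_le_left (ha i j) hγ
  have hO : IsUniqueOptimal (fun i => additive (a i)) (ownerAllocation o) :=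
    isUniqueOptimal_additive fun j i hi => (hle i j).trans_lt (h j i hi)
  refine ⟨hO, _, hO, fun i j => ?_⟩
  rw [perturb_additive]
  refine isUniqueOptimal_additive fun j' i' hi' => ?_
  have h1 := h j' i' hi'
  have h2 := hle i' j'
  have h3 := hle (o j') j'
  split_ifs <;> linarith

/-! ### Menu prices -/

/-- The additive valuation worth `2γ` on the items of `T` and `1/(2γ)` on all other items. -/
noncomputable def targetVal {m : ℕ} (γ : ℝ) (T : Finset (Fin m)) : SetFn m :=
  additive fun j => if j ∈ T then 2 * γ else 1 / (2 * γ)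

lemma targetVal_apply {m : ℕ} (γ : ℝ) (T S : Finset (Fin m)) :
    targetVal γ T S = 2 * γ * #(S ∩ T) + 1 / (2 * γ) * #(S \ T) := by
  simp only [targetVal, additive, sum_ite, sum_const, nsmul_eq_mul, filter_mem_eq_inter,
    filter_notMem_eq_sdiff]
  ring

lemma isSubmodular_targetVal {m : ℕ} {γ : ℝ} (hγ : 1 ≤ γ) (T : Finset (Fin m)) :
    IsSubmodular (targetVal γ T) :=
  isSubmodular_additive fun j => by split_ifs <;> positivity

/-- The profile in which bidder `i₀` has valuation `w`, bidder `i₁` values every bundle by its size,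
and the remaining bidders are indifferent. -/
def duelProfile {n m : ℕ} (i₀ i₁ : Fin n) (w : SetFn m) : Fin n → SetFn m :=
  Function.update (fun i => additive fun _ => if i = i₁ then 1 else 0) i₀ w

lemma isSubmodular_duelProfile {n m : ℕ} (i₀ i₁ : Fin n) {w : SetFn m} (hw : IsSubmodular w)
    (k : Fin n) : IsSubmodular (duelProfile i₀ i₁ w k) := by
  by_cases hk : k = i₀
  · subst hk
    simpa [duelProfile] using hw
  · rw [duelProfile, Function.update_of_ne hk]
    exact isSubmodular_additive fun j => by split_ifs <;> norm_num

lemma bundle_duelProfile_targetVal {n m : ℕ} {γ : ℝ} (hγ : 1 ≤ γ) {A : ValueQueryMechanism n m}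
    (hA : A.FindsOptimal γ) {i₀ i₁ : Fin n} (hi : i₀ ≠ i₁) (T : Finset (Fin m)) :
    (A.run (duelProfile i₀ i₁ (targetVal γ T))).bundle i₀ = T := by
  have hγ0 : 0 < γ := by linarith
  set a : Fin n → Fin m → ℝ := Function.update (fun i _ => if i = i₁ then 1 else 0) i₀
    (fun j => if j ∈ T then 2 * γ else 1 / (2 * γ)) with ha
  have hprof : duelProfile i₀ i₁ (targetVal γ T) = fun i => additive (a i) := by
    funext i
    by_cases h : i = i₀
    · subst h
      simp [duelProfile, a, targetVal]
    · simp [duelProfile, a, Function.update_of_ne h]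
  have hpos : ∀ i j, 0 ≤ a i j := fun i j => by
    by_cases h : i = i₀
    · subst h
      simp only [a, Function.update_self]
      split_ifs <;> positivity
    · simp only [a, Function.update_of_ne h]
      split_ifs <;> norm_num
  obtain ⟨hopt, hstable⟩ := isStable_additive hγ hpos (o := fun j => if j ∈ T then i₀ else i₁)
    fun j i hij => by
      have hβ : γ * (1 / (2 * γ)) < 1 := by
        field_simp
        norm_num
      by_cases hj : j ∈ T
      · rw [if_pos hj] at hij ⊢
        simp only [a, Function.update_self, Function.update_of_ne hij, if_pos hj]
        split_ifs <;> linarith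
      · rw [if_neg hj] at hij ⊢
        by_cases h : i = i₀
        · subst h
          simpa [a, Function.update_of_ne hi.symm, hj] using hβ
        · simp [a, Function.update_of_ne hi.symm, Function.update_of_ne h, hij]
  have hrun := hA (duelProfile i₀ i₁ (targetVal γ T))
    (isSubmodular_duelProfile i₀ i₁ (isSubmodular_targetVal hγ T)) (hprof ▸ hstable)
  rw [← hprof] at hopt
  rw [hopt.2 _ hrun]
  ext j
  by_cases hj : j ∈ T <;> simp [ownerAllocation, hj, hi.symm]

/-- Against the fixed opponents, bidder `i₀` can obtain every bundle `T` at a price `p T`, and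
truthfulness towards the bidder with valuation `targetVal γ T` bounds from below what any
submodular valuation pays. -/
lemma exists_prices {n m : ℕ} {γ : ℝ} (hγ : 1 ≤ γ) {A : ValueQueryMechanism n m}
    (hD : A.IsDSIC) (hA : A.FindsOptimal γ) {i₀ i₁ : Fin n} (hi : i₀ ≠ i₁) :
    ∃ p : Finset (Fin m) → ℝ,
      (∀ T S, p T + 1 / (2 * γ) * #(S \ T) - 2 * γ * #(T \ S) ≤ p S) ∧
      ∀ w, IsSubmodular w → ∀ T,
        (w T - p T ≤ (A.run (duelProfile i₀ i₁ w)).utility i₀ w) ∧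
        p T + 1 / (2 * γ) * #((A.run (duelProfile i₀ i₁ w)).bundle i₀ \ T)
            - 2 * γ * #(T \ (A.run (duelProfile i₀ i₁ w)).bundle i₀)
          ≤ (A.run (duelProfile i₀ i₁ w)).payment i₀ := by
  have hdsic : ∀ w w' : SetFn m, IsSubmodular w → IsSubmodular w' →
      (A.run (duelProfile i₀ i₁ w')).utility i₀ w ≤ (A.run (duelProfile i₀ i₁ w)).utility i₀ w := by
    intro w w' hw hw'
    simpa [duelProfile] using
      (hD (duelProfile i₀ i₁ w) (isSubmodular_duelProfile i₀ i₁ hw) i₀).1 w' hw'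
  have hb := bundle_duelProfile_targetVal hγ hA hi
  set p : Finset (Fin m) → ℝ := fun T => (A.run (duelProfile i₀ i₁ (targetVal γ T))).payment i₀
    with hp
  have hpay : ∀ w, IsSubmodular w → ∀ T,
      p T + 1 / (2 * γ) * #((A.run (duelProfile i₀ i₁ w)).bundle i₀ \ T)
          - 2 * γ * #(T \ (A.run (duelProfile i₀ i₁ w)).bundle i₀)
        ≤ (A.run (duelProfile i₀ i₁ w)).payment i₀ := by
    intro w hw T
    have h := hdsic (targetVal γ T) w (isSubmodular_targetVal hγ T) hw
    simp only [Outcome.utility, hb, targetVal_apply, inter_self, sdiff_self, bot_eq_empty,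
      card_empty, Nat.cast_zero] at h
    set B := (A.run (duelProfile i₀ i₁ w)).bundle i₀
    have hc : (#(T ∩ B) : ℝ) + #(T \ B) = #T := by exact_mod_cast card_inter_add_card_sdiff T B
    rw [inter_comm B T] at h
    have : 2 * γ * #T = 2 * γ * #(T ∩ B) + 2 * γ * #(T \ B) := by rw [← hc]; ring
    simp only [hp]
    linarith
  refine ⟨p, fun T S => ?_, fun w hw T => ⟨?_, hpay w hw T⟩⟩
  · simpa only [hb] using hpay _ (isSubmodular_targetVal hγ S) T
  · have h := hdsic w (targetVal γ T) hw (isSubmodular_targetVal hγ T)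
    simpa only [Outcome.utility, hb] using h

/-- Pigeonhole over bundle sizes and price windows of width `1/(4γ)`. -/
lemma exists_large_priced_family {m : ℕ} {γ : ℝ} (hγ : 1 ≤ γ) {p : Finset (Fin m) → ℝ}
    (hp : ∀ T S, p T + 1 / (2 * γ) * #(S \ T) - 2 * γ * #(T \ S) ≤ p S) {N : ℝ}
    (hN : ((m + 1 : ℝ) * (8 * γ ^ 2 * m + 1)) * N ≤ 2 ^ m) (hN0 : 0 ≤ N) :
    ∃ (F : Finset (Finset (Fin m))) (k : ℕ) (x : ℝ), N ≤ #F ∧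
      ∀ T ∈ F, #T = k ∧ x ≤ p T ∧ p T < x + 1 / (4 * γ) := by
  have hγ0 : 0 < γ := by linarith
  have hlow : ∀ T, 0 ≤ p T - p ∅ := fun T => by
    have h := hp ∅ T
    simp only [empty_sdiff, card_empty, Nat.cast_zero, mul_zero, sub_zero] at h
    have : 0 ≤ 1 / (2 * γ) * (#(T \ ∅) : ℝ) := by positivity
    linarith
  have hup : ∀ T, p T - p ∅ ≤ 2 * γ * m := fun T => by
    have h := hp T ∅
    simp only [empty_sdiff, card_empty, Nat.cast_zero, mul_zero, add_zero, sdiff_empty] at h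
    have hc : (#T : ℝ) ≤ m := by exact_mod_cast card_finset_fin_le T
    have : 2 * γ * (#T : ℝ) ≤ 2 * γ * m := by gcongr
    linarith
  set window : Finset (Fin m) → ℕ × ℕ := fun T => (#T, ⌊(p T - p ∅) * (4 * γ)⌋₊)
  set t : Finset (ℕ × ℕ) := range (m + 1) ×ˢ range (⌊8 * γ ^ 2 * (m : ℝ)⌋₊ + 1) with ht
  have hmaps : ∀ T ∈ (univ : Finset (Finset (Fin m))), window T ∈ t := fun T _ => by
    simp only [window, ht, mem_product, mem_range, Nat.lt_succ_iff]
    refine ⟨card_finset_fin_le T, Nat.floor_le_floor ?_⟩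
    calc (p T - p ∅) * (4 * γ) ≤ 2 * γ * m * (4 * γ) := by gcongr; exact hup T
      _ = 8 * γ ^ 2 * m := by ring
  have hcard : #t • N ≤ (#(univ : Finset (Finset (Fin m))) : ℝ) := by
    rw [nsmul_eq_mul, card_univ, Fintype.card_finset, Fintype.card_fin, ht, card_product,
      card_range, card_range]
    push_cast
    refine le_trans ?_ hN
    gcongr
    exact Nat.floor_le (by positivity)
  obtain ⟨y, -, hy⟩ := exists_le_card_fiber_of_nsmul_le_card_of_maps_to hmaps
    ⟨(0, 0), by simp [ht]⟩ hcard
  refine ⟨_, y.1, p ∅ + y.2 / (4 * γ), hy, fun T hT => ?_⟩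
  have hT' : window T = y := by simpa using hT
  have h1 : ⌊(p T - p ∅) * (4 * γ)⌋₊ = y.2 := by rw [← hT']
  have h2 := Nat.floor_le (mul_nonneg (hlow T) (by positivity : 0 ≤ 4 * γ))
  have h3 := Nat.lt_floor_add_one ((p T - p ∅) * (4 * γ))
  rw [h1] at h2 h3
  have h4 := (div_le_iff₀ (by positivity : 0 < 4 * γ)).2 h2
  have h5 := (lt_div_iff₀ (by positivity : 0 < 4 * γ)).2 h3
  rw [add_div] at h5
  exact ⟨by rw [← hT'], by linarith, by linarith⟩

/-! ### Submodular valuations supported by an antichain -/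

open scoped Classical in
/-- The loss of value at `S`: the prescribed amount `δ S` for the members of `F`, none strictly above
`F`, and an amount that halves with each added item if `S` contains no member of `F`. -/
noncomputable def deficit {m : ℕ} (F : Finset (Finset (Fin m))) (D : ℝ)
    (δ : Finset (Fin m) → ℝ) : SetFn m := fun S =>
  if S ∈ F then δ S else if ∃ T ∈ F, T ⊆ S then 0 else D * 2 ^ #Sᶜ

/-- The valuation that loses `deficit`, normalized at the empty bundle. -/
noncomputable def antichainVal {m : ℕ} (F : Finset (Finset (Fin m))) (D : ℝ)
    (δ : Finset (Fin m) → ℝ) : SetFn m := fun S => deficit F D δ ∅ - deficit F D δ S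

lemma deficit_of_mem {m : ℕ} {F : Finset (Finset (Fin m))} {D : ℝ} {δ : Finset (Fin m) → ℝ}
    {S : Finset (Fin m)} (h : S ∈ F) : deficit F D δ S = δ S := by
  simp [deficit, h]

lemma deficit_of_ssubset {m : ℕ} {F : Finset (Finset (Fin m))} {D : ℝ} {δ : Finset (Fin m) → ℝ}
    (hF : IsAntichain (· ⊆ ·) (F : Set (Finset (Fin m)))) {T S : Finset (Fin m)} (hT : T ∈ F)
    (h : T ⊂ S) : deficit F D δ S = 0 := by
  have hS : S ∉ F := fun hS => hF hT hS h.ne h.subset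
  rw [deficit, if_neg hS, if_pos ⟨T, hT, h.subset⟩]

lemma deficit_of_forall_not_subset {m : ℕ} {F : Finset (Finset (Fin m))} {D : ℝ}
    {δ : Finset (Fin m) → ℝ} {S : Finset (Fin m)} (h : ∀ T ∈ F, ¬ T ⊆ S) :
    deficit F D δ S = D * 2 ^ #Sᶜ := by
  have hS : S ∉ F := fun hS => h S hS Subset.rfl
  rw [deficit, if_neg hS, if_neg (by simpa using h)]

lemma deficit_nonneg {m : ℕ} {F : Finset (Finset (Fin m))} {D : ℝ} {δ : Finset (Fin m) → ℝ}
    (hD : 0 ≤ D) (hδ : ∀ S, 0 ≤ δ S) (S : Finset (Fin m)) : 0 ≤ deficit F D δ S := by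
  unfold deficit
  split_ifs
  · exact hδ S
  · exact le_rfl
  · positivity

lemma deficit_le {m : ℕ} {F : Finset (Finset (Fin m))} {D : ℝ} {δ : Finset (Fin m) → ℝ}
    (hD : 0 ≤ D) (hδ : ∀ S, δ S ≤ D) (S : Finset (Fin m)) :
    deficit F D δ S ≤ D * 2 ^ #Sᶜ := by
  unfold deficit
  split_ifs
  · exact (hδ S).trans (le_mul_of_one_le_right hD (one_le_pow₀ one_le_two))
  · positivity
  · exact le_rfl

/-- Below the up-closure of `F`, adding items at least halves the deficit. -/
lemma two_mul_deficit_le_of_ssubset {m : ℕ} {F : Finset (Finset (Fin m))} {D : ℝ}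
    {δ : Finset (Fin m) → ℝ} (hD : 0 ≤ D) (hδ : ∀ S, δ S ≤ D) {S S' : Finset (Fin m)}
    (hS : ∀ T ∈ F, ¬ T ⊆ S) (h : S ⊂ S') : 2 * deficit F D δ S' ≤ deficit F D δ S := by
  have hc : #S'ᶜ + 1 ≤ #Sᶜ := card_lt_card (compl_ssubset_compl.2 h)
  rw [deficit_of_forall_not_subset hS]
  calc 2 * deficit F D δ S' ≤ 2 * (D * 2 ^ #S'ᶜ) := by gcongr; exact deficit_le hD hδ S'
    _ = D * 2 ^ (#S'ᶜ + 1) := by ring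
    _ ≤ D * 2 ^ #Sᶜ := by gcongr; norm_num

lemma isSubmodular_antichainVal {m : ℕ} {F : Finset (Finset (Fin m))} {D : ℝ}
    {δ : Finset (Fin m) → ℝ} (hF : IsAntichain (· ⊆ ·) (F : Set (Finset (Fin m)))) (hD : 0 ≤ D)
    (hδ0 : ∀ S, 0 ≤ δ S) (hδ : ∀ S, δ S ≤ D) : IsSubmodular (antichainVal F D δ) := by
  have h0 := deficit_nonneg (F := F) hD hδ0
  refine ⟨⟨sub_self _, fun S S' h => ?_⟩, fun S S' => ?_⟩
  · simp only [antichainVal]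
    rcases h.eq_or_ssubset with rfl | h
    · exact le_rfl
    by_cases hS : ∀ T ∈ F, ¬ T ⊆ S
    · linarith [two_mul_deficit_le_of_ssubset hD hδ hS h, h0 S']
    · push Not at hS
      obtain ⟨T, hT, hTS⟩ := hS
      linarith [deficit_of_ssubset (D := D) (δ := δ) hF hT (hTS.trans_ssubset h), h0 S]
  · simp only [antichainVal]
    by_cases h1 : S ⊆ S'
    · rw [inter_eq_left.2 h1, union_eq_right.2 h1]
    by_cases h2 : S' ⊆ S
    · rw [inter_eq_right.2 h2, union_eq_left.2 h2, add_comm]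
    have hl : S ∩ S' ⊂ S := inter_subset_left.ssubset_of_ne fun h => h1 (inter_eq_left.1 h)
    have hr : S ∩ S' ⊂ S' := inter_subset_right.ssubset_of_ne fun h => h2 (inter_eq_right.1 h)
    by_cases hS : ∀ T ∈ F, ¬ T ⊆ S ∩ S'
    · linarith [two_mul_deficit_le_of_ssubset hD hδ hS hl,
        two_mul_deficit_le_of_ssubset hD hδ hS hr, h0 (S ∪ S')]
    · push Not at hS
      obtain ⟨T, hT, hTS⟩ := hS
      have hu : T ⊂ S ∪ S' := (hTS.trans_ssubset hl).trans_subset subset_union_left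
      linarith [deficit_of_ssubset (D := D) (δ := δ) hF hT (hTS.trans_ssubset hl),
        deficit_of_ssubset (D := D) (δ := δ) hF hT (hTS.trans_ssubset hr),
        deficit_of_ssubset (D := D) (δ := δ) hF hT hu, h0 (S ∩ S')]

/-! ### Query complexity -/

/-- A run is determined by the answers of the other bidders and by the answers of bidder `i` on at
most as many bundles as there are queries. -/
lemma ValueQueryMechanism.exists_queried {n m : ℕ} (A : ValueQueryMechanism n m)
    (b : Fin n → SetFn m) (i : Fin n) :
    ∃ Q : Finset (Finset (Fin m)), #Q ≤ A.numQueries b ∧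
      ∀ w : SetFn m, (∀ S ∈ Q, w S = b i S) → A.run (Function.update b i w) = A.run b := by
  induction A with
  | finish o => exact ⟨∅, by simp, fun w _ => rfl⟩
  | query k S next ih =>
    obtain ⟨Q, hQ, hrun⟩ := ih (b k S)
    refine ⟨insert S Q, ?_, fun w hw => ?_⟩
    · exact (card_insert_le S Q).trans (Nat.add_le_add_right hQ 1)
    · have hk : Function.update b i w k S = b k S := by
        by_cases h : k = i
        · subst h
          simpa using hw S (mem_insert_self S Q)
        · rw [Function.update_of_ne h]
      simp only [ValueQueryMechanism.run, hk]
      exact hrun w fun S' hS' => hw S' (mem_insert_of_mem hS')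

/-- If bidder `i₀` faces almost equal prices on an antichain `F`, then on a suitable profile all
members of `F` but at most one are queried. -/
lemma card_le_numQueries_add_one {n m : ℕ} {γ : ℝ} (hγ : 1 ≤ γ) {A : ValueQueryMechanism n m}
    {i₀ i₁ : Fin n} {p : Finset (Fin m) → ℝ}
    (hp : ∀ w, IsSubmodular w → ∀ T,
        (w T - p T ≤ (A.run (duelProfile i₀ i₁ w)).utility i₀ w) ∧
        p T + 1 / (2 * γ) * #((A.run (duelProfile i₀ i₁ w)).bundle i₀ \ T)
            - 2 * γ * #(T \ (A.run (duelProfile i₀ i₁ w)).bundle i₀)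
          ≤ (A.run (duelProfile i₀ i₁ w)).payment i₀)
    {F : Finset (Finset (Fin m))} (hF : IsAntichain (· ⊆ ·) (F : Set (Finset (Fin m))))
    (hempty : ∅ ∉ F) {x : ℝ} (hx : ∀ T ∈ F, x ≤ p T ∧ p T < x + 1 / (4 * γ)) :
    ∃ w : SetFn m, IsSubmodular w ∧ #F ≤ A.numQueries (duelProfile i₀ i₁ w) + 1 := by
  have hγ0 : 0 < γ := by linarith
  set β : ℝ := 1 / (2 * γ) with hβ
  have hβ0 : 0 < β := by positivity
  have hβ4 : 1 / (4 * γ) = β / 2 := by rw [hβ]; field_simp; norm_num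
  rw [hβ4] at hx
  -- Exceeds the largest possible price difference `2γm` by the deficit `β` of the members of `F`.
  set D : ℝ := 2 * γ * m + β with hDdef
  have hm0 : 0 ≤ 2 * γ * (m : ℝ) := by positivity
  have hD0 : 0 ≤ D := by positivity
  set w : SetFn m := antichainVal F D fun _ => β with hw
  have hwsub : IsSubmodular w :=
    isSubmodular_antichainVal hF hD0 (fun _ => hβ0.le) fun _ => by linarith
  obtain ⟨Q, hQ, hrun⟩ := A.exists_queried (duelProfile i₀ i₁ w) i₀
  set B := (A.run (duelProfile i₀ i₁ w)).bundle i₀ with hB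
  set q := (A.run (duelProfile i₀ i₁ w)).payment i₀ with hq
  refine ⟨w, hwsub, ?_⟩
  suffices hsub : F ⊆ insert B Q from
    (card_le_card hsub).trans ((card_insert_le B Q).trans (Nat.add_le_add_right hQ 1))
  intro T hT
  rw [mem_insert]
  by_contra! hne
  obtain ⟨hTB, hTQ⟩ := hne
  set δ : Finset (Fin m) → ℝ := Function.update (fun _ => β) T 0 with hδ
  have hδ0 : ∀ S, 0 ≤ δ S := fun S => by
    by_cases h : S = T
    · simp [hδ, h]
    · simp [hδ, Function.update_of_ne h, hβ0.le]
  have hδD : ∀ S, δ S ≤ D := fun S => by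
    by_cases h : S = T
    · simpa [hδ, h] using hD0
    · simp only [hδ, Function.update_of_ne h]
      linarith
  set w' : SetFn m := antichainVal F D δ with hw'
  have hdef : ∀ S, S ≠ T → deficit F D δ S = deficit F D (fun _ => β) S := fun S hS => by
    simp [deficit, hδ, Function.update_of_ne hS]
  have hw'w : ∀ S ∈ Q, w' S = duelProfile i₀ i₁ w i₀ S := fun S hS => by
    have h1 : S ≠ T := fun h => hTQ (h ▸ hS)
    have h2 : ∅ ≠ T := fun h => hempty (h ▸ hT)
    simp [duelProfile, hw, hw', antichainVal, hdef S h1, hdef ∅ h2]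
  have hsame : A.run (duelProfile i₀ i₁ w') = A.run (duelProfile i₀ i₁ w) := by
    simpa [duelProfile] using hrun w' hw'w
  -- With `w'` the bidder still receives `B`, and so must not prefer to buy `T`.
  have hprefer := (hp w' (isSubmodular_antichainVal hF hD0 hδ0 hδD) T).1
  rw [hsame, Outcome.utility, ← hB, ← hq, hw'] at hprefer
  simp only [antichainVal, deficit_of_mem hT, hdef B hTB.symm] at hprefer
  have hδT : δ T = 0 := by simp [hδ]
  have hpay : ∀ S, p S + β * #(B \ S) - 2 * γ * #(S \ B) ≤ q := fun S => (hp w hwsub S).2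
  obtain ⟨hxT, hTx⟩ := hx T hT
  by_cases hBF : B ∈ F
  · rw [deficit_of_mem hBF] at hprefer
    have h1 := hpay B
    simp only [sdiff_self, bot_eq_empty, card_empty, Nat.cast_zero, mul_zero] at h1
    linarith [(hx B hBF).1]
  by_cases hup : ∀ S ∈ F, ¬ S ⊆ B
  · rw [deficit_of_forall_not_subset hup] at hprefer
    have h1 := hpay T
    have h2 : 0 ≤ β * (#(B \ T) : ℝ) := by positivity
    have h3 : 2 * γ * (#(T \ B) : ℝ) ≤ 2 * γ * m := by
      gcongr
      exact_mod_cast card_finset_fin_le (T \ B)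
    have h4 : D ≤ D * 2 ^ #Bᶜ := le_mul_of_one_le_right hD0 (one_le_pow₀ one_le_two)
    linarith
  · push Not at hup
    obtain ⟨S, hS, hSB⟩ := hup
    have hSB' : S ⊂ B := hSB.ssubset_of_ne fun h => hBF (h ▸ hS)
    rw [deficit_of_ssubset hF hS hSB'] at hprefer
    have h1 := hpay S
    rw [sdiff_eq_empty_iff_subset.2 hSB, card_empty, Nat.cast_zero, mul_zero, sub_zero] at h1
    have h2 : (1 : ℝ) ≤ #(B \ S) := by
      exact_mod_cast card_pos.2 (sdiff_nonempty.2 hSB'.2)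
    have h3 : β * 1 ≤ β * (#(B \ S) : ℝ) := by gcongr
    linarith [(hx S hS).1]

/-- The growth estimate behind the constant `1/2` in the exponent. -/
lemma exists_forall_poly_mul_le_two_pow {γ : ℝ} :
    ∃ m₀ : ℕ, ∀ m : ℕ, m₀ ≤ m →
      ((m + 1 : ℝ) * (8 * γ ^ 2 * m + 1)) * (2 ^ (1 / 2 * (m : ℝ)) + 1) ≤ 2 ^ m := by
  have hr : 1 < (2 : ℝ) ^ (1 / 2 : ℝ) := Real.one_lt_rpow one_lt_two (by norm_num)
  set C : ℝ := 4 * (8 * γ ^ 2 + 1) with hC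
  have hC0 : 0 < C := by positivity
  have h := (tendsto_pow_const_div_const_pow_of_one_lt 2 hr).eventually
    (gt_mem_nhds (inv_pos.2 hC0))
  obtain ⟨m₀, hm₀⟩ := Filter.eventually_atTop.1 h
  refine ⟨max m₀ 1, fun m hm => ?_⟩
  have hpow : (2 : ℝ) ^ (1 / 2 * (m : ℝ)) = ((2 : ℝ) ^ (1 / 2 : ℝ)) ^ m := by
    rw [Real.rpow_mul zero_le_two, Real.rpow_natCast]
  have hsq : (2 : ℝ) ^ m = ((2 : ℝ) ^ (1 / 2 : ℝ)) ^ m * ((2 : ℝ) ^ (1 / 2 : ℝ)) ^ m := by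
    rw [← mul_pow, ← Real.rpow_add two_pos]
    norm_num
  rw [hpow, hsq]
  set R : ℝ := ((2 : ℝ) ^ (1 / 2 : ℝ)) ^ m
  have hR : 1 ≤ R := one_le_pow₀ hr.le
  have hm1 : (1 : ℝ) ≤ m := by exact_mod_cast (le_max_right m₀ 1).trans hm
  have h1 := hm₀ m ((le_max_left m₀ 1).trans hm)
  rw [div_lt_iff₀ (by positivity), inv_mul_eq_div, lt_div_iff₀ hC0] at h1
  have h2 : 8 * γ ^ 2 * m + 1 ≤ (8 * γ ^ 2 + 1) * m := by linarith
  calc ((m + 1 : ℝ) * (8 * γ ^ 2 * m + 1)) * (R + 1)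
      ≤ ((2 * m : ℝ) * ((8 * γ ^ 2 + 1) * m)) * (2 * R) := by gcongr <;> linarith
    _ = (m ^ 2 * C) * R := by rw [hC]; ring
    _ ≤ R * R := by gcongr

theorem mainTheorem4 :
    ∃ c : ℝ, 0 < c ∧ ∀ γ : ℝ, 1 ≤ γ → ∃ m₀ : ℕ, ∀ m : ℕ, m₀ ≤ m → ∀ n : ℕ, 2 ≤ n →
      ∀ A : ValueQueryMechanism n m, A.IsDSIC → A.FindsOptimal γ →
        ∃ v : Fin n → SetFn m, (∀ i, IsSubmodular (v i)) ∧
          (2 : ℝ) ^ (c * (m : ℝ)) ≤ (A.numQueries v : ℝ) := by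
  refine ⟨1 / 2, by norm_num, fun γ hγ => ?_⟩
  obtain ⟨m₀, hm₀⟩ := exists_forall_poly_mul_le_two_pow (γ := γ)
  refine ⟨m₀, fun m hm n hn A hD hA => ?_⟩
  set i₀ : Fin n := ⟨0, by omega⟩
  set i₁ : Fin n := ⟨1, by omega⟩
  have hi : i₀ ≠ i₁ := by simp [i₀, i₁]
  obtain ⟨p, hpp, hp⟩ := exists_prices hγ hD hA hi
  obtain ⟨F, k, x, hcard, hF⟩ := exists_large_priced_family hγ hpp (hm₀ m hm) (by positivity)
  have hanti : IsAntichain (· ⊆ ·) (F : Set (Finset (Fin m))) := fun S hS T hT hne h =>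
    hne (eq_of_subset_of_card_le h ((hF T hT).1.trans (hF S hS).1.symm).le)
  have hempty : ∅ ∉ F := fun h => by
    -- All members of `F` would be empty, but `F` has more than one member.
    have hsub : F ⊆ {∅} := fun S hS => by
      rw [mem_singleton, ← card_eq_zero, (hF S hS).1, ← (hF ∅ h).1, card_empty]
    have h1 : (#F : ℝ) ≤ 1 := by exact_mod_cast card_le_card hsub
    have : (0 : ℝ) < 2 ^ (1 / 2 * (m : ℝ)) := by positivity
    linarith
  obtain ⟨w, hw, hle⟩ := card_le_numQueries_add_one hγ hp hanti hempty fun T hT => (hF T hT).2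
  refine ⟨duelProfile i₀ i₁ w, isSubmodular_duelProfile i₀ i₁ hw, ?_⟩
  have : (#F : ℝ) ≤ A.numQueries (duelProfile i₀ i₁ w) + 1 := by exact_mod_cast hle
  linarith
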